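/- For an integer $n\ge 3$ let $P_n=\operatorname{conv}(1,\zeta_n,\dots,\zeta_n^{n-1})\subset\mathbb C=\mathbb R^2$, $\zeta_n=\cos(2\pi/n)+i\sin(2\pi/n)$, be the standard regular $n$-gon, and let $\operatorname{Hom}(P_n,P_3)$ be the polytope of all affine maps $f:P_n\to P_3$, a convex subset of the real vector space of affine maps $\mathbb R^2\to\mathbb R^2$. The rank of $f$ is the dimension of its image $f(P_n)$. Then for every $n\ge 3$ the number of vertices of $\operatorname{Hom}(P_n,P_3)$ of full rank, that is, of rank two, is finite and equal to $$\begin{cases}\dfrac{n(n+1)(n-1)}{4} & \text{for } n \text{ odd},\\[2mm] \dfrac{n(n-2)(n-4)}{4} & \text{for } n \text{ even}.\end{cases}$$ -/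

import Mathlib

/-- The root of unity `ζ_n = cos (2π / n) + sin (2π / n) i`. -/
noncomputable def zeta (n : ℕ) : ℂ :=
  ⟨Real.cos (2 * Real.pi / n), Real.sin (2 * Real.pi / n)⟩

/-- The standard regular `n`-gon `P_n = conv (1, ζ_n, ζ_n ^ 2, …, ζ_n ^ (n - 1))` in the real
plane `ℂ` (used for `n ≥ 3`). -/
noncomputable def regularPolygon (n : ℕ) : Set ℂ :=
  convexHull ℝ (Set.range fun k : Fin n => zeta n ^ (k : ℕ))

/-- The hom-polytope `Hom (P, Q)` of all affine maps `P → Q`, for a polytope `P` that affinely spans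
its ambient space `E`, as a subset of the real vector space of affine maps `E → E'`.
Since `P` spans `E`, an affine map on `P` is the same thing as an affine map on `E`; regular
polygons do span the plane, see `affineSpan_regularPolygon` below. -/
def homPolytope {E E' : Type*} [AddCommGroup E] [Module ℝ E] [AddCommGroup E'] [Module ℝ E']
    (P : Set E) (Q : Set E') : Set (E →ᵃ[ℝ] E') :=
  {f | ∀ x ∈ P, f x ∈ Q}

/-- The rank of an affine map `f` on `P`: the dimension of (the affine hull of) its image `f (P)`. -/
noncomputable def homRank {E E' : Type*} [AddCommGroup E] [Module ℝ E] [AddCommGroup E']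
    [Module ℝ E'] (P : Set E) (f : E →ᵃ[ℝ] E') : ℕ :=
  Module.finrank ℝ (vectorSpan ℝ (f '' P))

/-- The vertices of `Hom (P, Q)` (vertices of a polytope are its extreme points) of rank `r`. -/
def homVerticesOfRank {E E' : Type*} [AddCommGroup E] [Module ℝ E] [AddCommGroup E']
    [Module ℝ E'] (P : Set E) (Q : Set E') (r : ℕ) : Set (E →ᵃ[ℝ] E') :=
  {f | f ∈ Set.extremePoints ℝ (homPolytope P Q) ∧ homRank P f = r}

theorem affineSpan_regularPolygon (n : ℕ) (hn : 3 ≤ n) :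
    affineSpan ℝ (regularPolygon n) = ⊤ := by
  have hn' : (3 : ℝ) ≤ n := by exact_mod_cast hn
  have hpi := Real.pi_pos
  have hpos : 0 < 2 * Real.pi / n := by positivity
  have hlt : 2 * Real.pi / n < Real.pi := by
    rw [div_lt_iff₀ (by linarith)]; nlinarith
  have hs : 0 < Real.sin (2 * Real.pi / n) := Real.sin_pos_of_pos_of_lt_pi hpos hlt
  have hc : Real.cos (2 * Real.pi / n) < 1 := by
    nlinarith [Real.sin_sq_add_cos_sq (2 * Real.pi / n)]
  have hz : zeta n = Complex.exp (2 * Real.pi * Complex.I / n) := by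
    have h : (2 * Real.pi * Complex.I / n : ℂ) = ((2 * Real.pi / n : ℝ) : ℂ) * Complex.I := by
      push_cast; ring
    rw [h]
    apply Complex.ext
    · rw [Complex.exp_ofReal_mul_I_re, zeta]
    · rw [Complex.exp_ofReal_mul_I_im, zeta]
  have hzn : zeta n ^ n = 1 := by
    rw [hz]; exact (Complex.isPrimitiveRoot_exp n (by omega)).pow_eq_one
  have hconj : zeta n ^ (n - 1) = ⟨Real.cos (2 * Real.pi / n), -Real.sin (2 * Real.pi / n)⟩ := by
    have h0 : zeta n ≠ 0 := by rw [hz]; exact Complex.exp_ne_zero _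
    apply mul_right_cancel₀ h0
    rw [← pow_succ, Nat.sub_add_cancel (by omega), hzn]
    have h1 := Real.sin_sq_add_cos_sq (2 * Real.pi / n)
    apply Complex.ext <;> simp [zeta] <;> nlinarith
  have hmem : ∀ k < n, zeta n ^ k ∈ regularPolygon n := fun k hk =>
    subset_convexHull ℝ _ ⟨⟨k, hk⟩, rfl⟩
  have h0 := hmem 0 (by omega)
  have h1 := hmem 1 (by omega)
  have h2 := hmem (n - 1) (by omega)
  rw [hconj] at h2
  rw [pow_zero] at h0
  rw [pow_one] at h1
  rw [AffineSubspace.affineSpan_eq_top_iff_vectorSpan_eq_top_of_nonempty ℝ ℂ ℂ ⟨_, h0⟩,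
    eq_top_iff]
  intro w _
  have e1 := vsub_mem_vectorSpan ℝ h1 h0
  have e2 := vsub_mem_vectorSpan ℝ h2 h0
  set c := Real.cos (2 * Real.pi / n) with hcd
  set s := Real.sin (2 * Real.pi / n) with hsd
  have hc' : c - 1 ≠ 0 := by linarith
  have hw : w = (w.re / (2 * (c - 1)) + w.im / (2 * s)) • (zeta n -ᵥ 1) +
      (w.re / (2 * (c - 1)) - w.im / (2 * s)) • ((⟨c, -s⟩ : ℂ) -ᵥ 1) := by
    apply Complex.ext
    · simp only [zeta, ← hcd, ← hsd, Complex.add_re, Complex.smul_re, Complex.sub_re, vsub_eq_sub,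
        Complex.one_re, smul_eq_mul]
      field_simp; ring
    · simp only [zeta, ← hcd, ← hsd, Complex.add_im, Complex.smul_im, Complex.sub_im, vsub_eq_sub,
        Complex.one_im, smul_eq_mul]
      field_simp; ring
  rw [hw]
  exact Submodule.add_mem _ (Submodule.smul_mem _ _ e1) (Submodule.smul_mem _ _ e2)

/-! In barycentric coordinates of the triangle, a map in the hom-polytope is a triple of affine
functions, nonnegative on `P_n`, with sum 1. For an extreme map of full rank each coordinate must
vanish along a whole edge of `P_n`: a coordinate with at most one zero among the vertices leaves
room to rescale the other two slightly and compensate in this one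
(`exists_eq_mul_edgeFn_of_extreme`). So the coordinates are positive multiples of edge functions for
edges `i`, `j`, `k`.

For the sum to be constant, the three unit edge normals must satisfy a linear relation with positive
coefficients. These normals themselves form a regular `n`-gon on the unit circle, and a positive
relation of rank two exists exactly when they span an acute triangle, that is, have the origin in
its interior; `mul_arcSin_eq` expresses this by signs of sines. The sum being 1 then fixes the
coefficients (`eq_zero_of_edgeFn_sum`). Conversely, every acute triple gives a vertex, because zeros
along edges are inherited by both ends of a segment through the map (`vertexMap_mem`).

Full-rank vertices thus correspond to ordered acute triples, which `card_acuteTriples` counts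
through a starting point, two consecutive arcs and an orientation. -/

open Filter Topology

/-! ### Affine functions on the plane -/

/-- The real affine function `z ↦ c + p * re z + q * im z` on the plane. -/
noncomputable def affineFn (c p q : ℝ) : ℂ →ᵃ[ℝ] ℝ :=
  (p • Complex.reLm + q • Complex.imLm).toAffineMap + AffineMap.const ℝ ℂ c

@[simp] theorem affineFn_apply (c p q : ℝ) (z : ℂ) :
    affineFn c p q z = c + p * z.re + q * z.im := by
  simp [affineFn]; ring

theorem affineFn_eta (g : ℂ →ᵃ[ℝ] ℝ) (z : ℂ) :
    g z = g 0 + g.linear 1 * z.re + g.linear Complex.I * z.im := by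
  have h1 : g z = g.linear z + g 0 := by
    have := g.map_vadd 0 z
    simpa using this
  have h2 : z = z.re • (1 : ℂ) + z.im • Complex.I := by
    apply Complex.ext <;> simp
  have h3 : g.linear z = z.re * g.linear 1 + z.im * g.linear Complex.I := by
    conv_lhs => rw [h2]
    simp only [map_add, map_smul, smul_eq_mul]
  rw [h1, h3]; ring

/-! ### Vertices of the regular polygon -/

theorem zeta_pow (n k : ℕ) :
    zeta n ^ k = ⟨Real.cos (2 * Real.pi * k / n), Real.sin (2 * Real.pi * k / n)⟩ := by
  have hz : ∀ x : ℝ, (⟨Real.cos x, Real.sin x⟩ : ℂ) = Complex.exp (x * Complex.I) := by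
    intro x
    apply Complex.ext
    · rw [Complex.exp_ofReal_mul_I_re]
    · rw [Complex.exp_ofReal_mul_I_im]
  rw [zeta, hz, hz, ← Complex.exp_nat_mul]
  congr 1
  push_cast; ring

theorem zeta_pow_self {n : ℕ} (hn : n ≠ 0) : zeta n ^ n = 1 := by
  have : (n : ℝ) ≠ 0 := by exact_mod_cast hn
  rw [zeta_pow, mul_div_assoc, div_self this, mul_one]
  apply Complex.ext <;> simp

theorem zeta_pow_mod {n : ℕ} (hn : n ≠ 0) (k : ℕ) : zeta n ^ (k % n) = zeta n ^ k := by
  conv_rhs => rw [← Nat.mod_add_div k n, pow_add, pow_mul, zeta_pow_self hn, one_pow, mul_one]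

theorem zeta_pow_mem {n : ℕ} (hn : n ≠ 0) (k : ℕ) : zeta n ^ k ∈ regularPolygon n := by
  rw [← zeta_pow_mod hn]
  exact subset_convexHull ℝ _ ⟨⟨k % n, Nat.mod_lt _ (Nat.pos_of_ne_zero hn)⟩, rfl⟩

/-! ### Barycentric coordinates on the triangle -/

/-- The barycentric coordinates with respect to the vertices of `P_3`. -/
noncomputable def bary : Fin 3 → (ℂ →ᵃ[ℝ] ℝ) :=
  ![affineFn (1 / 3) (2 / 3) 0, affineFn (1 / 3) (-1 / 3) (√3 / 3),
    affineFn (1 / 3) (-1 / 3) (-√3 / 3)]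

/-- The affine map into the plane with given barycentric coordinates with respect to `P_3`. -/
noncomputable def ofBary (g : Fin 3 → (ℂ →ᵃ[ℝ] ℝ)) : ℂ →ᵃ[ℝ] ℂ :=
  ∑ m : Fin 3, (LinearMap.toSpanSingleton ℝ ℂ (zeta 3 ^ (m : ℕ))).toAffineMap.comp (g m)

theorem zeta_three : zeta 3 = ⟨-1 / 2, √3 / 2⟩ := by
  have h : (2 * Real.pi / (3 : ℕ) : ℝ) = Real.pi - Real.pi / 3 := by push_cast; ring
  rw [zeta, h, Real.cos_pi_sub, Real.sin_pi_sub, Real.cos_pi_div_three, Real.sin_pi_div_three]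
  norm_num

theorem zeta_three_sq : zeta 3 ^ 2 = ⟨-1 / 2, -√3 / 2⟩ := by
  have h3 : √3 * √3 = 3 := Real.mul_self_sqrt (by norm_num)
  rw [zeta_three, sq]
  apply Complex.ext <;> simp <;> nlinarith

theorem ofBary_apply (g : Fin 3 → (ℂ →ᵃ[ℝ] ℝ)) (z : ℂ) :
    ofBary g z = ⟨g 0 z - (g 1 z + g 2 z) / 2, √3 / 2 * (g 1 z - g 2 z)⟩ := by
  have h : ofBary g z = g 0 z • (1 : ℂ) + g 1 z • zeta 3 + g 2 z • zeta 3 ^ 2 := by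
    simp [ofBary, Fin.sum_univ_three]
  rw [h, zeta_three_sq, zeta_three]
  apply Complex.ext <;> simp <;> ring

theorem bary_ofBary (g : Fin 3 → (ℂ →ᵃ[ℝ] ℝ)) (z : ℂ) (hg : g 0 z + g 1 z + g 2 z = 1)
    (m : Fin 3) : bary m (ofBary g z) = g m z := by
  have h3 : √3 * √3 = 3 := Real.mul_self_sqrt (by norm_num)
  rw [ofBary_apply]
  fin_cases m <;> simp [bary]
  · linear_combination (-1 / 3) * hg
  · linear_combination (-1 / 3) * hg + (g 1 z - g 2 z) / 6 * h3
  · linear_combination (-1 / 3) * hg - (g 1 z - g 2 z) / 6 * h3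

theorem bary_sum (z : ℂ) : bary 0 z + bary 1 z + bary 2 z = 1 := by
  simp [bary]; ring

theorem ofBary_bary (f : ℂ →ᵃ[ℝ] ℂ) : ofBary (fun m => (bary m).comp f) = f := by
  have h3 : √3 * √3 = 3 := Real.mul_self_sqrt (by norm_num)
  ext z
  rw [ofBary_apply]
  apply Complex.ext
  · simp [bary]; ring
  · simp [bary]
    linear_combination (f z).im / 3 * h3

theorem ext_of_bary {z w : ℂ} (h : ∀ m, bary m z = bary m w) : z = w := by
  have h3 : (0 : ℝ) < √3 := by positivity
  have h0 := h 0
  have h1 := h 1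
  simp [bary] at h0 h1
  apply Complex.ext
  · exact h0
  · rw [h0] at h1
    simpa [h3.ne'] using h1

theorem mem_triangle_iff (z : ℂ) : z ∈ regularPolygon 3 ↔ ∀ m, 0 ≤ bary m z := by
  constructor
  · intro hz m
    have hc : Convex ℝ {z | 0 ≤ bary m z} := (convex_Ici (0 : ℝ)).affine_preimage (bary m)
    refine convexHull_min ?_ hc hz
    rintro _ ⟨k, rfl⟩
    have h3 : √3 * √3 = 3 := Real.mul_self_sqrt (by norm_num)
    have hk : zeta 3 ^ (k : ℕ) = 1 ∨ zeta 3 ^ (k : ℕ) = ⟨-1 / 2, √3 / 2⟩ ∨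
        zeta 3 ^ (k : ℕ) = ⟨-1 / 2, -√3 / 2⟩ := by
      rw [← zeta_three_sq, ← zeta_three]
      fin_cases k <;> simp
    rcases hk with hk | hk | hk <;> simp only [hk, Set.mem_ofPred_eq] <;> fin_cases m <;>
      simp [bary] <;> nlinarith
  · intro h
    have hz : ∑ m : Fin 3, bary m z • zeta 3 ^ (m : ℕ) = z := by
      have := congrArg (fun f => f z) (ofBary_bary (AffineMap.id ℝ ℂ))
      simpa [ofBary, Fin.sum_univ_three] using this
    rw [← hz]
    refine (convex_convexHull ℝ _).sum_mem (fun m _ => h m) ?_ fun m _ => zeta_pow_mem (by simp) _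
    rw [Fin.sum_univ_three, bary_sum]

theorem mem_homPolytope_iff {n : ℕ} (hn : n ≠ 0) (f : ℂ →ᵃ[ℝ] ℂ) :
    f ∈ homPolytope (regularPolygon n) (regularPolygon 3) ↔
      ∀ (m : Fin 3) (k : ℕ), 0 ≤ bary m (f (zeta n ^ k)) := by
  constructor
  · intro h m k
    exact (mem_triangle_iff _).1 (h _ (zeta_pow_mem hn k)) m
  · intro h x hx
    have hc : Convex ℝ (f ⁻¹' regularPolygon 3) := (convex_convexHull ℝ _).affine_preimage f
    refine convexHull_min ?_ hc hx
    rintro _ ⟨k, rfl⟩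
    exact (mem_triangle_iff _).2 fun m => h m k

/-- Since `P_n` spans the plane, the directions in its image fill the range of the linear part. -/
theorem homRank_eq_two_iff {n : ℕ} (hn : 3 ≤ n) (f : ℂ →ᵃ[ℝ] ℂ) :
    homRank (regularPolygon n) f = 2 ↔ Function.Surjective f.linear := by
  have h1 : vectorSpan ℝ (f '' regularPolygon n) = LinearMap.range f.linear := by
    rw [← AffineMap.map_vectorSpan, ← direction_affineSpan, affineSpan_regularPolygon n hn,
      AffineSubspace.direction_top, Submodule.map_top]
  rw [homRank, h1, ← LinearMap.range_eq_top]
  constructor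
  · intro h
    exact Submodule.eq_top_of_finrank_eq (by rw [h, Complex.finrank_real_complex])
  · intro h
    rw [h, finrank_top, Complex.finrank_real_complex]

/-! ### Edge functions of the regular polygon -/

/-- The function `cos δ - ⟨u, z⟩` for the unit vector `u` at angle `M`; it vanishes on the chord of
the unit circle between the angles `M - δ` and `M + δ`. -/
noncomputable def chordFn (M δ : ℝ) : ℂ →ᵃ[ℝ] ℝ := affineFn (Real.cos δ) (-Real.cos M) (-Real.sin M)

theorem chordFn_apply (M δ : ℝ) (z : ℂ) :
    chordFn M δ z = Real.cos δ - (Real.cos M * z.re + Real.sin M * z.im) := by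
  simp [chordFn]; ring

/-- Sum-to-product for `cos δ - cos (x - M)`. In this factored form, signs on the circle can be read
off. -/
theorem chordFn_circle (M δ x : ℝ) : chordFn M δ ⟨Real.cos x, Real.sin x⟩ =
    2 * Real.sin ((x - (M - δ)) / 2) * Real.sin ((x - (M + δ)) / 2) := by
  have e : M = (x - (x - (M - δ)) / 2 - (x - (M + δ)) / 2) := by ring
  have e' : δ = (x - (M - δ)) / 2 - (x - (M + δ)) / 2 := by ring
  rw [chordFn_apply]
  have h1 : Real.cos M * Real.cos x + Real.sin M * Real.sin x =
      Real.cos ((x - (M - δ)) / 2 + (x - (M + δ)) / 2) := by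
    rw [← Real.cos_sub, ← Real.cos_neg]; congr 1; ring
  have h2 : Real.cos δ = Real.cos ((x - (M - δ)) / 2 - (x - (M + δ)) / 2) := by
    congr 1
  dsimp only
  rw [h1, h2, Real.cos_add, Real.cos_sub]; ring

/-- An affine function vanishing at two points of the unit circle is a multiple of the chord
function. -/
theorem exists_eq_mul_chordFn (g : ℂ →ᵃ[ℝ] ℝ) (M δ : ℝ) (hδ : Real.sin δ ≠ 0)
    (h1 : g ⟨Real.cos (M + δ), Real.sin (M + δ)⟩ = 0)
    (h2 : g ⟨Real.cos (M - δ), Real.sin (M - δ)⟩ = 0) :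
    ∃ c : ℝ, ∀ z, g z = c * chordFn M δ z := by
  rw [affineFn_eta] at h1 h2
  dsimp only at h1 h2
  rw [Real.cos_add, Real.sin_add] at h1
  rw [Real.cos_sub, Real.sin_sub] at h2
  set α := g 0
  set p := g.linear 1 with hp
  set q := g.linear Complex.I with hq
  have hcs := Real.sin_sq_add_cos_sq M
  have e1 : q * Real.cos M = p * Real.sin M := by
    apply mul_left_cancel₀ hδ; linarith
  have e2 : α + Real.cos δ * (p * Real.cos M + q * Real.sin M) = 0 := by linarith
  refine ⟨-(p * Real.cos M + q * Real.sin M), fun z => ?_⟩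
  rw [affineFn_eta, chordFn_apply, ← hp, ← hq]
  have hpe : p = (p * Real.cos M + q * Real.sin M) * Real.cos M := by
    linear_combination (-p) * hcs - Real.sin M * e1
  have hqe : q = (p * Real.cos M + q * Real.sin M) * Real.sin M := by
    linear_combination (-q) * hcs + Real.cos M * e1
  linear_combination e2 + z.re * hpe + z.im * hqe

/-- The affine function vanishing on the edge from `ζ ^ j` to `ζ ^ (j + 1)`. -/
noncomputable def edgeFn (n j : ℕ) : ℂ →ᵃ[ℝ] ℝ :=
  chordFn ((2 * j + 1) * Real.pi / n) (Real.pi / n)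

theorem sin_pos_of_lt {n : ℕ} {d : ℝ} (h0 : 0 < d) (h1 : d < n) :
    0 < Real.sin (Real.pi * d / n) := by
  have hn : (0 : ℝ) < n := h0.trans h1
  have := Real.pi_pos
  apply Real.sin_pos_of_pos_of_lt_pi (by positivity)
  rw [div_lt_iff₀ hn]
  nlinarith

theorem sin_neg_of_lt {n : ℕ} {d : ℝ} (h0 : d < 0) (h1 : -n < d) :
    Real.sin (Real.pi * d / n) < 0 := by
  have h := sin_pos_of_lt (n := n) (d := -d) (by linarith) (by linarith)
  rw [mul_neg, neg_div, Real.sin_neg] at h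
  linarith

theorem cos_pi_div_pos {n : ℕ} (hn : 3 ≤ n) : 0 < Real.cos (Real.pi / n) := by
  have hn' : (3 : ℝ) ≤ n := by exact_mod_cast hn
  have := Real.pi_pos
  have hpos : 0 < Real.pi / n := by positivity
  apply Real.cos_pos_of_mem_Ioo ⟨by linarith, ?_⟩
  rw [div_lt_iff₀ (by linarith)]
  nlinarith

theorem chordFn_zeta_pow {n : ℕ} (a b : ℝ) (k : ℕ) :
    chordFn ((a + b) * Real.pi / n) ((b - a) * Real.pi / n) (zeta n ^ k) =
      2 * Real.sin (Real.pi * (k - a) / n) * Real.sin (Real.pi * (k - b) / n) := by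
  rw [zeta_pow, chordFn_circle]
  congr 2
  · congr 1; ring
  · ring

theorem edgeFn_eq (n j : ℕ) : edgeFn n j =
    chordFn ((j + (j + 1 : ℝ)) * Real.pi / n) (((j + 1 : ℝ) - j) * Real.pi / n) := by
  rw [edgeFn]; congr 1 <;> ring

theorem edgeFn_zeta_pow (n j k : ℕ) : edgeFn n j (zeta n ^ k) =
    2 * Real.sin (Real.pi * (k - j) / n) * Real.sin (Real.pi * (k - (j + 1)) / n) := by
  rw [edgeFn_eq, chordFn_zeta_pow]

/-- No integer lies strictly between `j` and `j + 1`, so after reducing `k` modulo `n` the two sine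
factors never have opposite signs. -/
theorem edgeFn_zeta_pow_nonneg {n : ℕ} (hn : n ≠ 0) {j : ℕ} (hj : j < n) (k : ℕ) :
    0 ≤ edgeFn n j (zeta n ^ k) := by
  rw [← zeta_pow_mod hn, edgeFn_zeta_pow]
  have hk : k % n < n := Nat.mod_lt _ (Nat.pos_of_ne_zero hn)
  generalize k % n = k at hk
  have hk' : (k : ℝ) + 1 ≤ n := by exact_mod_cast hk
  have hj' : (j : ℝ) + 1 ≤ n := by exact_mod_cast hj
  have hk0 : (0 : ℝ) ≤ k := by positivity
  have hj0 : (0 : ℝ) ≤ j := by positivity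
  rcases lt_trichotomy k j with h | rfl | h
  · have h' : (k : ℝ) + 1 ≤ j := by exact_mod_cast h
    have s1 := sin_neg_of_lt (n := n) (d := k - j) (by linarith) (by linarith)
    -- Equality is the wrap-around case `k = 0`, `j = n - 1`, where the vertex is the far end of the
    -- edge.
    rcases eq_or_lt_of_le (show -(n : ℝ) ≤ k - (j + 1) by linarith) with h2 | h2
    · have : (n : ℝ) ≠ 0 := by exact_mod_cast hn
      rw [← h2, mul_neg, neg_div, mul_div_cancel_right₀ _ this]; simp
    · have s2 := sin_neg_of_lt (n := n) (d := k - (j + 1)) (by linarith) h2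
      nlinarith
  · simp
  · have h' : (j : ℝ) + 1 ≤ k := by exact_mod_cast h
    have s1 := sin_pos_of_lt (n := n) (d := k - j) (by linarith) (by linarith)
    rcases eq_or_lt_of_le h' with h2 | h2
    · rw [h2]; simp
    · have s2 := sin_pos_of_lt (n := n) (d := k - (j + 1)) (by linarith) (by linarith)
      positivity

theorem edgeFn_zeta_pow_add_two_pos {n : ℕ} (hn : 3 ≤ n) (j : ℕ) :
    0 < edgeFn n j (zeta n ^ (j + 2)) := by
  have hn' : (3 : ℝ) ≤ n := by exact_mod_cast hn
  rw [edgeFn_zeta_pow]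
  push_cast
  have s1 := sin_pos_of_lt (n := n) (d := j + 2 - j) (by linarith) (by linarith)
  have s2 := sin_pos_of_lt (n := n) (d := j + 2 - (j + 1)) (by linarith) (by linarith)
  positivity

@[simp] theorem edgeFn_zeta_pow_self (n j : ℕ) : edgeFn n j (zeta n ^ j) = 0 := by
  rw [edgeFn_zeta_pow]; simp

@[simp] theorem edgeFn_zeta_pow_succ (n j : ℕ) : edgeFn n j (zeta n ^ (j + 1)) = 0 := by
  rw [edgeFn_zeta_pow]; simp

@[simp] theorem edgeFn_zero (n j : ℕ) : edgeFn n j 0 = Real.cos (Real.pi / n) := by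
  simp [edgeFn, chordFn_apply]

/-- An affine function vanishing at both ends of an edge is a multiple of the edge function. -/
theorem exists_eq_mul_edgeFn {n : ℕ} (hn : 3 ≤ n) (g : ℂ →ᵃ[ℝ] ℝ) (j : ℕ)
    (h0 : g (zeta n ^ j) = 0) (h1 : g (zeta n ^ (j + 1)) = 0) :
    ∃ c : ℝ, ∀ z, g z = c * edgeFn n j z := by
  have hn' : (3 : ℝ) ≤ n := by exact_mod_cast hn
  apply exists_eq_mul_chordFn
  · have := sin_pos_of_lt (n := n) (d := 1) (by norm_num) (by linarith)
    rw [mul_one] at this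
    exact this.ne'
  · rw [← h1, zeta_pow]; congr 3 <;> (push_cast; ring)
  · rw [← h0, zeta_pow]; congr 3 <;> ring

/-- A nonzero affine function that is nonnegative on a regular polygon and vanishes at two vertices
vanishes on an edge. -/
theorem exists_edge {n : ℕ} (hn : 3 ≤ n) (g : ℂ →ᵃ[ℝ] ℝ) (hg : ∀ k, 0 ≤ g (zeta n ^ k))
    (hne : ∃ z, g z ≠ 0) {a b : ℕ} (hab : a < b) (hb : b < n)
    (ha0 : g (zeta n ^ a) = 0) (hb0 : g (zeta n ^ b) = 0) :
    ∃ j < n, g (zeta n ^ j) = 0 ∧ g (zeta n ^ (j + 1)) = 0 := by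
  have hab' : (a : ℝ) + 1 ≤ b := by exact_mod_cast hab
  have hb' : (b : ℝ) + 1 ≤ n := by exact_mod_cast hb
  have ha' : (0 : ℝ) ≤ a := by positivity
  by_cases h1 : b = a + 1
  · subst h1; exact ⟨a, by omega, ha0, hb0⟩
  by_cases h2 : a = 0 ∧ b + 1 = n
  · refine ⟨b, hb, hb0, ?_⟩
    rw [h2.2, zeta_pow_self (by omega), ← ha0, h2.1, pow_zero]
  exfalso
  obtain ⟨c, hc⟩ : ∃ c : ℝ, ∀ z, g z =
      c * chordFn (((a : ℝ) + b) * Real.pi / n) (((b : ℝ) - a) * Real.pi / n) z := by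
    apply exists_eq_mul_chordFn
    · have := sin_pos_of_lt (n := n) (d := b - a) (by linarith) (by linarith)
      rw [mul_comm] at this
      exact this.ne'
    · rw [← hb0, zeta_pow]; congr 3 <;> ring
    · rw [← ha0, zeta_pow]; congr 3 <;> ring
  have hv : ∀ k : ℕ, 0 ≤ c * (2 * Real.sin (Real.pi * (k - a) / n) *
      Real.sin (Real.pi * (k - b) / n)) := by
    intro k
    rw [← chordFn_zeta_pow, ← hc]; exact hg k
  have hab2 : (a : ℝ) + 2 ≤ b := by exact_mod_cast (by omega : a + 2 ≤ b)
  -- Two non-adjacent vertices have vertices strictly on both sides of their chord. The one after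
  -- `a` forces `c ≤ 0`; one on the other side forces `c ≥ 0`.
  have hc0 : c ≤ 0 := by
    have h := hv (a + 1)
    push_cast at h
    have s1 := sin_pos_of_lt (n := n) (d := a + 1 - a) (by linarith) (by linarith)
    have s2 := sin_neg_of_lt (n := n) (d := a + 1 - b) (by linarith) (by linarith)
    by_contra hcon
    push Not at hcon
    have := mul_neg_of_pos_of_neg (mul_pos (mul_pos hcon two_pos) s1) s2
    linarith
  have hc1 : 0 ≤ c := by
    by_contra hcon
    push Not at hcon
    by_cases h3 : b + 1 < n
    · have h := hv (b + 1)
      push_cast at h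
      have h3' : (b : ℝ) + 1 < n := by exact_mod_cast h3
      have s1 := sin_pos_of_lt (n := n) (d := b + 1 - a) (by linarith) (by linarith)
      have s2 := sin_pos_of_lt (n := n) (d := b + 1 - b) (by linarith) (by linarith)
      have := mul_pos (mul_pos (mul_pos (neg_pos.2 hcon) two_pos) s1) s2
      linarith
    -- Here `b` is the last index, so `a` is positive by `h2` and its predecessor lies beyond the
    -- chord.
    · obtain ⟨a', rfl⟩ : ∃ a', a = a' + 1 := ⟨a - 1, by omega⟩
      have h := hv a'
      push_cast at h hab' ha'
      have s1 := sin_neg_of_lt (n := n) (d := a' - (a' + 1)) (by linarith) (by linarith)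
      have ha'' : (0 : ℝ) ≤ a' := by positivity
      have s2 := sin_neg_of_lt (n := n) (d := a' - b) (by linarith) (by linarith)
      have := mul_pos (mul_pos (mul_pos (neg_pos.2 hcon) two_pos) (neg_pos.2 s1)) (neg_pos.2 s2)
      linarith
  obtain ⟨z, hz⟩ := hne
  apply hz
  rw [hc, le_antisymm hc0 hc1, zero_mul]
/-! ### Counting acute triangles -/

/-- Pairs of consecutive arcs of an inscribed acute triangle of the regular `n`-gon. -/
def acuteArcs (n : ℕ) : Finset (ℕ × ℕ) :=
  (Finset.range n ×ˢ Finset.range n).filter fun p =>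
    0 < p.1 ∧ 2 * p.1 < n ∧ 0 < p.2 ∧ 2 * p.2 < n ∧ n < 2 * (p.1 + p.2)

/-- The arc from `i` to `j` on a circle with `n` points is shorter than a half circle. -/
def ShortArc (n i j : ℕ) : Prop := (i < j ∧ 2 * j < n + 2 * i) ∨ (2 * j + n < 2 * i)

instance (n i j : ℕ) : Decidable (ShortArc n i j) := by unfold ShortArc; infer_instance

/-- Ordered triples of vertices of the regular `n`-gon spanning a positively oriented acute
triangle. -/
def posAcute (n : ℕ) : Finset (ℕ × ℕ × ℕ) :=
  (Finset.range n ×ˢ Finset.range n ×ˢ Finset.range n).filter fun t =>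
    ShortArc n t.1 t.2.1 ∧ ShortArc n t.2.1 t.2.2 ∧ ShortArc n t.2.2 t.1

/-- Ordered triples of vertices of the regular `n`-gon spanning a negatively oriented acute
triangle. -/
def negAcute (n : ℕ) : Finset (ℕ × ℕ × ℕ) :=
  (Finset.range n ×ˢ Finset.range n ×ˢ Finset.range n).filter fun t =>
    ShortArc n t.2.1 t.1 ∧ ShortArc n t.2.2 t.2.1 ∧ ShortArc n t.1 t.2.2

theorem mem_posAcute {n i j k : ℕ} : (i, j, k) ∈ posAcute n ↔
    (i < n ∧ j < n ∧ k < n) ∧ ShortArc n i j ∧ ShortArc n j k ∧ ShortArc n k i := by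
  simp [posAcute]

theorem mem_negAcute {n i j k : ℕ} : (i, j, k) ∈ negAcute n ↔
    (i < n ∧ j < n ∧ k < n) ∧ ShortArc n j i ∧ ShortArc n k j ∧ ShortArc n i k := by
  simp [negAcute]

/-- A triple is encoded by its first point and its first two arc lengths. The third arc is what
remains of `n`, and its shortness is the last condition in `acuteArcs`. -/
theorem card_posAcute (n : ℕ) : (posAcute n).card = n * (acuteArcs n).card := by
  have h : (Finset.range n ×ˢ acuteArcs n).card = n * (acuteArcs n).card := by
    rw [Finset.card_product, Finset.card_range]
  rw [← h]
  refine Finset.card_nbij'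
    (fun t => (t.1, (if t.1 ≤ t.2.1 then t.2.1 - t.1 else t.2.1 + n - t.1),
      (if t.2.1 ≤ t.2.2 then t.2.2 - t.2.1 else t.2.2 + n - t.2.1)))
    (fun t => (t.1, (if t.1 + t.2.1 < n then t.1 + t.2.1 else t.1 + t.2.1 - n),
      (if t.1 + t.2.1 + t.2.2 < n then t.1 + t.2.1 + t.2.2 else
        t.1 + t.2.1 + t.2.2 - n))) ?_ ?_ ?_ ?_
  all_goals
    rintro ⟨i, j, k⟩ ht
    simp only [mem_posAcute, acuteArcs, ShortArc, Finset.mem_filter,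
      Finset.mem_product, Finset.mem_range, Finset.coe_product, Set.mem_prod,
      Finset.mem_coe, Prod.mk.injEq] at ht ⊢
  · split_ifs <;> omega
  · split_ifs <;> omega
  · refine ⟨trivial, ?_, ?_⟩ <;> split_ifs <;> omega
  · refine ⟨trivial, ?_, ?_⟩ <;> split_ifs <;> omega

theorem card_negAcute (n : ℕ) : (negAcute n).card = (posAcute n).card := by
  refine Finset.card_nbij' (fun t => (t.1, t.2.2, t.2.1)) (fun t => (t.1, t.2.2, t.2.1))
    ?_ ?_ ?_ ?_
  all_goals
    rintro ⟨i, j, k⟩ ht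
    simp only [mem_posAcute, mem_negAcute, Finset.mem_coe] at ht ⊢
    try tauto

theorem card_acuteArcs_odd (h : ℕ) : (acuteArcs (2 * h + 1)).card * 2 = h * (h + 1) := by
  have e : acuteArcs (2 * h + 1) =
      ((Finset.range (h + 1)).sigma fun p => Finset.Ico (h + 1 - p) (h + 1)).image
        fun x => (x.1, x.2) := by
    ext ⟨p, q⟩
    simp only [acuteArcs, Finset.mem_filter, Finset.mem_product, Finset.mem_range,
      Finset.mem_image, Finset.mem_sigma, Finset.mem_Ico, Prod.mk.injEq, Sigma.exists]
    constructor
    · intro _; exact ⟨p, q, by omega, rfl, rfl⟩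
    · rintro ⟨p', q', _, rfl, rfl⟩; omega
  rw [e, Finset.card_image_of_injective, Finset.card_sigma]
  -- A first arc `p` leaves exactly `p` choices for the second.
  · rw [Finset.sum_congr rfl (g := fun p => p), Finset.sum_range_id_mul_two]
    · simp [mul_comm]
    · intro p hp
      rw [Finset.mem_range] at hp
      rw [Nat.card_Ico]; omega
  · rintro ⟨a, b⟩ ⟨c, d⟩ hh
    simpa using hh

theorem card_acuteArcs_even (h : ℕ) : (acuteArcs (2 * h + 2)).card * 2 = h * (h - 1) := by
  have e : acuteArcs (2 * h + 2) =
      ((Finset.range h).sigma fun p => Finset.Ico (h + 1 - p) (h + 1)).image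
        fun x => (x.1 + 1, x.2) := by
    ext ⟨p, q⟩
    simp only [acuteArcs, Finset.mem_filter, Finset.mem_product, Finset.mem_range,
      Finset.mem_image, Finset.mem_sigma, Finset.mem_Ico, Prod.mk.injEq, Sigma.exists]
    constructor
    -- For even `n` the strict inequalities cost one choice: a first arc `p` leaves `p - 1`, hence
    -- the shifted index.
    · intro _; exact ⟨p - 1, q, by omega, by omega, rfl⟩
    · rintro ⟨p', q', _, rfl, rfl⟩; omega
  rw [e, Finset.card_image_of_injective, Finset.card_sigma]
  · rw [Finset.sum_congr rfl (g := fun p => p), Finset.sum_range_id_mul_two]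
    intro p hp
    rw [Finset.mem_range] at hp
    rw [Nat.card_Ico]; omega
  · rintro ⟨a, b⟩ ⟨c, d⟩ hh
    simpa using hh

/-- Ordered triples of vertices of the regular `n`-gon spanning an acute triangle. -/
def acuteTriples (n : ℕ) : Finset (ℕ × ℕ × ℕ) := posAcute n ∪ negAcute n

theorem card_acuteTriples (n : ℕ) :
    (acuteTriples n).card = n * ((acuteArcs n).card * 2) := by
  rw [acuteTriples, Finset.card_union_of_disjoint, card_negAcute, card_posAcute]
  · ring
  · rw [Finset.disjoint_left]
    rintro ⟨i, j, k⟩ h1 h2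
    simp only [mem_posAcute, mem_negAcute, ShortArc] at h1 h2
    omega

/-! ### Vertices of full rank -/

theorem exists_bary_eq {f : ℂ →ᵃ[ℝ] ℂ} (hf : Function.Surjective f) (m : Fin 3) :
    ∃ z, ∀ k, bary k (f z) = if k = m then 1 else 0 := by
  have key : ∃ w : ℂ, ∀ k, bary k w = if k = m then 1 else 0 := by
    refine ⟨ofBary (fun k => AffineMap.const ℝ ℂ (if k = m then 1 else 0)) 0, fun k => ?_⟩
    rw [bary_ofBary]
    · simp
    · fin_cases m <;> simp
  obtain ⟨w, hw⟩ := key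
  obtain ⟨z, rfl⟩ := hf w
  exact ⟨z, hw⟩

theorem eventually_mul_abs_le {x : ℝ} (hx : 0 < x) (y : ℝ) : ∀ᶠ ε in 𝓝[>] (0 : ℝ), ε * |y| ≤ x := by
  apply nhdsWithin_le_nhds
  have h : Tendsto (fun ε : ℝ => ε * |y|) (𝓝 0) (𝓝 (0 * |y|)) := by
    exact (continuous_id.mul continuous_const).tendsto 0
  rw [zero_mul] at h
  exact (h.eventually (gt_mem_nhds hx)).mono fun _ h => le_of_lt h

/-- In barycentric coordinates, a point of the hom-polytope is extreme only if there is no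
perturbation direction `h`. -/
theorem eq_zero_of_extreme {n : ℕ} (hn : n ≠ 0) {f : ℂ →ᵃ[ℝ] ℂ}
    (hf : f ∈ Set.extremePoints ℝ (homPolytope (regularPolygon n) (regularPolygon 3)))
    (h : Fin 3 → (ℂ →ᵃ[ℝ] ℝ)) (hsum : h 0 + h 1 + h 2 = 0)
    (hpos : ∀ m k, |h m (zeta n ^ k)| ≤ bary m (f (zeta n ^ k))) (m : Fin 3) : h m = 0 := by
  have hs : ∀ z, h 0 z + h 1 z + h 2 z = 0 := fun z => by
    simpa using congrArg (fun g => g z) hsum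
  let F : ℝ → (ℂ →ᵃ[ℝ] ℂ) := fun t => ofBary fun m => (bary m).comp f + t • h m
  have hF : ∀ t m z, bary m (F t z) = bary m (f z) + t * h m z := by
    intro t m z
    rw [bary_ofBary]
    · simp
    · simp only [AffineMap.coe_add, Pi.add_apply, AffineMap.coe_comp, Function.comp_apply,
        AffineMap.coe_smul, Pi.smul_apply, smul_eq_mul]
      linear_combination bary_sum (f z) + t * hs z
  have hmem : ∀ t : ℝ, |t| = 1 →
      F t ∈ homPolytope (regularPolygon n) (regularPolygon 3) := by
    intro t ht
    rw [mem_homPolytope_iff hn]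
    intro m k
    rw [hF]
    have h1 := neg_abs_le (t * h m (zeta n ^ k))
    rw [abs_mul, ht, one_mul] at h1
    linarith [hpos m k]
  have hmid : f ∈ openSegment ℝ (F 1) (F (-1)) := by
    refine ⟨1 / 2, 1 / 2, by norm_num, by norm_num, by norm_num, ?_⟩
    ext z
    apply ext_of_bary
    intro m
    have e : ((1 / 2 : ℝ) • F 1 + (1 / 2 : ℝ) • F (-1)) z =
        AffineMap.lineMap (F 1 z) (F (-1) z) (1 / 2 : ℝ) := by
      rw [AffineMap.lineMap_apply_module]
      simp only [AffineMap.coe_add, Pi.add_apply, AffineMap.coe_smul, Pi.smul_apply]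
      norm_num
    rw [e, AffineMap.apply_lineMap, hF, hF, AffineMap.lineMap_apply_module]
    simp only [smul_eq_mul]
    ring
  have := hf.2 (hmem 1 (by simp)) (hmem (-1) (by simp)) hmid
  ext z
  have h1 := hF 1 m z
  rw [this] at h1
  simpa using h1

/-- If coordinate `m` has at most one zero among the vertices, adding small multiples of the other
two coordinates to themselves and subtracting them from `m` contradicts extremality. Hence there are
two zeros, and `exists_edge` supplies an edge. -/
theorem exists_eq_mul_edgeFn_of_extreme {n : ℕ} (hn : 3 ≤ n) {f : ℂ →ᵃ[ℝ] ℂ}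
    (hf : f ∈ Set.extremePoints ℝ (homPolytope (regularPolygon n) (regularPolygon 3)))
    (hsurj : Function.Surjective f) (m : Fin 3) :
    ∃ j < n, ∃ c > 0, ∀ z, bary m (f z) = c * edgeFn n j z := by
  have hn0 : n ≠ 0 := by omega
  have hnn := (mem_homPolytope_iff hn0 f).1 hf.1
  have two : ∃ a b, a < b ∧ b < n ∧ bary m (f (zeta n ^ a)) = 0 ∧
      bary m (f (zeta n ^ b)) = 0 := by
    by_contra hcon
    push Not at hcon
    obtain ⟨a, ha⟩ : ∃ a, ∀ k < n, k ≠ a → 0 < bary m (f (zeta n ^ k)) := by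
      by_cases h : ∃ a < n, bary m (f (zeta n ^ a)) = 0
      · obtain ⟨a, han, ha⟩ := h
        refine ⟨a, fun k hk hka => lt_of_le_of_ne (hnn m k) fun h0 => ?_⟩
        rcases lt_or_gt_of_ne hka with hlt | hlt
        · exact hcon k a hlt han h0.symm ha
        · exact hcon a k hlt hk ha h0.symm
      · push Not at h
        exact ⟨0, fun k hk _ => lt_of_le_of_ne (hnn m k) (h k hk).symm⟩
    obtain ⟨p, q, hp, hq, hpm, hqm, hpq, hsum⟩ : ∃ p q : Fin 3, p ≠ m ∧ q ≠ m ∧ m ≠ p ∧ m ≠ q ∧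
        p ≠ q ∧ ∀ h : Fin 3 → (ℂ →ᵃ[ℝ] ℝ), h 0 + h 1 + h 2 = h m + h p + h q := by
      fin_cases m
      · exact ⟨1, 2, by decide, by decide, by decide, by decide, by decide, fun h => rfl⟩
      · exact ⟨2, 0, by decide, by decide, by decide, by decide, by decide,
          fun h => by simp only [Fin.mk_one]; abel⟩
      · exact ⟨0, 1, by decide, by decide, by decide, by decide, by decide,
          fun h => by simp only [Fin.reduceFinMk]; abel⟩
    -- The one possible zero of coordinate `m` has no slack, so the perturbation has to vanish
    -- there; two parameters suffice for this one linear condition.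
    obtain ⟨b, c, hbc, hv⟩ : ∃ b c : ℝ, (b ≠ 0 ∨ c ≠ 0) ∧
        b * bary p (f (zeta n ^ a)) + c * bary q (f (zeta n ^ a)) = 0 := by
      by_cases h : bary p (f (zeta n ^ a)) = 0
      · exact ⟨1, 0, by simp, by simp [h]⟩
      · exact ⟨bary q (f (zeta n ^ a)), -bary p (f (zeta n ^ a)), by simp [h], by ring⟩
    have hev : ∀ᶠ ε in 𝓝[>] (0 : ℝ), 0 < ε ∧ ε * |b| ≤ 1 ∧ ε * |c| ≤ 1 ∧
        ∀ k ∈ (Finset.range n).erase a,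
          ε * |b * bary p (f (zeta n ^ k)) + c * bary q (f (zeta n ^ k))| ≤
            bary m (f (zeta n ^ k)) := by
      refine Eventually.and self_mem_nhdsWithin <| (eventually_mul_abs_le one_pos b).and <|
        (eventually_mul_abs_le one_pos c).and ?_
      rw [Filter.eventually_all_finset]
      intro k hk
      rw [Finset.mem_erase, Finset.mem_range] at hk
      exact eventually_mul_abs_le (ha k hk.2 hk.1) _
    obtain ⟨ε, hε, hb1, hc1, hk1⟩ := hev.exists
    let h : Fin 3 → (ℂ →ᵃ[ℝ] ℝ) := fun i =>
      if i = m then -(ε * b) • (bary p).comp f - (ε * c) • (bary q).comp f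
      else if i = p then (ε * b) • (bary p).comp f else (ε * c) • (bary q).comp f
    have hm' : h m = -(ε * b) • (bary p).comp f - (ε * c) • (bary q).comp f := by simp [h]
    have hp' : h p = (ε * b) • (bary p).comp f := by simp [h, hp]
    have hq' : h q = (ε * c) • (bary q).comp f := by simp [h, hq, hpq.symm]
    have hzero := eq_zero_of_extreme hn0 hf h
      (by rw [hsum, hm', hp', hq']; module) (by
        intro i k
        rw [← zeta_pow_mod hn0]
        have hk : k % n < n := Nat.mod_lt _ (Nat.pos_of_ne_zero hn0)
        generalize k % n = k at hk
        by_cases him : i = m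
        · rw [him, hm']
          have e : (-(ε * b) • (bary p).comp f - (ε * c) • (bary q).comp f) (zeta n ^ k) =
              -(ε * (b * bary p (f (zeta n ^ k)) + c * bary q (f (zeta n ^ k)))) := by
            simp; ring
          rw [e, abs_neg, abs_mul, abs_of_pos hε]
          by_cases hka : k = a
          · rw [hka, hv]; simpa using hnn m a
          · exact hk1 k (by simp [hka, hk])
        · by_cases hip : i = p
          · rw [hip, hp']
            simp only [AffineMap.coe_smul, Pi.smul_apply, AffineMap.coe_comp, Function.comp_apply, smul_eq_mul,
              abs_mul, abs_of_pos hε, abs_of_nonneg (hnn p k)]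
            exact mul_le_of_le_one_left (hnn p k) hb1
          · have hiq : i = q := by omega
            rw [hiq, hq']
            simp only [AffineMap.coe_smul, Pi.smul_apply, AffineMap.coe_comp, Function.comp_apply, smul_eq_mul,
              abs_mul, abs_of_pos hε, abs_of_nonneg (hnn q k)]
            exact mul_le_of_le_one_left (hnn q k) hc1)
    -- Surjectivity makes the other coordinates nonzero functions, so the perturbation is not
    -- trivial.
    rcases hbc with hb | hc
    · obtain ⟨z, hz⟩ := exists_bary_eq hsurj p
      have := congrArg (fun g => g z) (hzero p)
      simp [hp', hz, hb, hε.ne'] at this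
    · obtain ⟨z, hz⟩ := exists_bary_eq hsurj q
      have := congrArg (fun g => g z) (hzero q)
      simp [hq', hz, hc, hε.ne'] at this
  obtain ⟨a, b, hab, hb, ha0, hb0⟩ := two
  obtain ⟨z, hz⟩ := exists_bary_eq hsurj m
  obtain ⟨j, hj, hj0, hj1⟩ := exists_edge hn ((bary m).comp f) (hnn m)
    ⟨z, by simp [hz]⟩ hab hb ha0 hb0
  obtain ⟨c, hc⟩ := exists_eq_mul_edgeFn hn _ j hj0 hj1
  refine ⟨j, hj, c, ?_, hc⟩
  have hc0 : 0 ≤ c := by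
    have h1 := hnn m (j + 2)
    have h2 := hc (zeta n ^ (j + 2))
    rw [AffineMap.comp_apply] at h2
    rw [h2] at h1
    exact nonneg_of_mul_nonneg_left h1 (edgeFn_zeta_pow_add_two_pos hn j)
  refine lt_of_le_of_ne hc0 fun h0 => ?_
  have := hc z
  rw [AffineMap.comp_apply, hz, ← h0] at this
  simp at this

/-! ### Vertices of full rank and acute triangles -/

/-- The sine of the angle from the `i`-th to the `j`-th edge normal. -/
noncomputable def arcSin (n i j : ℕ) : ℝ := Real.sin (Real.pi * (2 * ((j : ℝ) - i)) / n)

theorem arcSin_swap (n i j : ℕ) : arcSin n j i = -arcSin n i j := by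
  rw [arcSin, arcSin, ← Real.sin_neg]; congr 1; ring

theorem sin_add_two_mul {n : ℕ} (hn : n ≠ 0) (x : ℝ) :
    Real.sin (Real.pi * (x + 2 * n) / n) = Real.sin (Real.pi * x / n) := by
  have : (n : ℝ) ≠ 0 := by exact_mod_cast hn
  rw [← Real.sin_add_two_pi (Real.pi * x / n)]; congr 1; field_simp

theorem sin_nonpos_of_le {n : ℕ} {d : ℝ} (hn : n ≠ 0) (h0 : d ≤ 0) (h1 : -n ≤ d) :
    Real.sin (Real.pi * d / n) ≤ 0 := by
  have hn' : (0 : ℝ) < n := by positivity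
  have := Real.pi_pos
  apply Real.sin_nonpos_of_nonpos_of_neg_pi_le
  · exact div_nonpos_of_nonpos_of_nonneg (by nlinarith) hn'.le
  · rw [le_div_iff₀ hn']; nlinarith

/-- The sine of a central angle is positive exactly when the oriented arc is shorter than a half
circle; wrapping past index 0 adds a full turn. -/
theorem shortArc_iff {n i j : ℕ} (hi : i < n) (hj : j < n) :
    ShortArc n i j ↔ 0 < arcSin n i j := by
  have hn : n ≠ 0 := by omega
  have hi' : (i : ℝ) < n := by exact_mod_cast hi
  have hj' : (j : ℝ) < n := by exact_mod_cast hj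
  have hi0 : (0 : ℝ) ≤ i := by positivity
  have hj0 : (0 : ℝ) ≤ j := by positivity
  constructor
  · rintro (⟨h1, h2⟩ | h)
    · have h1' : (i : ℝ) < j := by exact_mod_cast h1
      have h2' : (2 : ℝ) * j < n + 2 * i := by exact_mod_cast h2
      exact sin_pos_of_lt (by linarith) (by linarith)
    · have h' : (2 : ℝ) * j + n < 2 * i := by exact_mod_cast h
      rw [arcSin, ← sin_add_two_mul hn]
      exact sin_pos_of_lt (by linarith) (by linarith)
  · contrapose!
    intro h
    simp only [ShortArc, not_or, not_and, not_lt] at h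
    have h2 : (2 : ℝ) * i ≤ 2 * j + n := by exact_mod_cast h.2
    by_cases hij : i < j
    · have h1 : (n : ℝ) + 2 * i ≤ 2 * j := by exact_mod_cast h.1 hij
      have e : (2 * ((j : ℝ) - i)) = (2 * ((j : ℝ) - i) - 2 * n) + 2 * n := by ring
      rw [arcSin, e, sin_add_two_mul hn]
      exact sin_nonpos_of_le hn (by linarith) (by linarith)
    · have h1 : (j : ℝ) ≤ i := by exact_mod_cast not_lt.1 hij
      exact sin_nonpos_of_le hn (by linarith) (by linarith)

theorem mem_acuteTriples {n i j k : ℕ} : (i, j, k) ∈ acuteTriples n ↔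
    (i < n ∧ j < n ∧ k < n) ∧ ((0 < arcSin n i j ∧ 0 < arcSin n j k ∧ 0 < arcSin n k i) ∨
      (arcSin n i j < 0 ∧ arcSin n j k < 0 ∧ arcSin n k i < 0)) := by
  rw [acuteTriples, Finset.mem_union, mem_posAcute, mem_negAcute, ← and_or_left]
  refine and_congr_right fun ⟨hi, hj, hk⟩ => ?_
  rw [shortArc_iff hi hj, shortArc_iff hj hk, shortArc_iff hk hi, shortArc_iff hj hi,
    shortArc_iff hk hj, shortArc_iff hi hk, arcSin_swap n i j, arcSin_swap n j k,
    arcSin_swap n k i]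
  simp only [neg_pos]

theorem edgeFn_apply (n j : ℕ) (z : ℂ) : edgeFn n j z = Real.cos (Real.pi / n) -
    (Real.cos ((2 * j + 1) * Real.pi / n) * z.re + Real.sin ((2 * j + 1) * Real.pi / n) * z.im) := by
  rw [edgeFn, chordFn_apply]

theorem arcSin_eq (n i j : ℕ) : arcSin n i j =
    Real.sin ((2 * j + 1) * Real.pi / n) * Real.cos ((2 * i + 1) * Real.pi / n) -
      Real.cos ((2 * j + 1) * Real.pi / n) * Real.sin ((2 * i + 1) * Real.pi / n) := by
  rw [← Real.sin_sub, arcSin]; congr 1; ring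

/-- The plane identity `(v × w) u + (w × u) v + (u × v) w = 0` for the three normals kills the
linear part. -/
theorem arcSin_mul_edgeFn_sum (n i j k : ℕ) (z : ℂ) :
    arcSin n j k * edgeFn n i z + arcSin n k i * edgeFn n j z + arcSin n i j * edgeFn n k z =
      (arcSin n j k + arcSin n k i + arcSin n i j) * Real.cos (Real.pi / n) := by
  simp only [edgeFn_apply, arcSin_eq]; ring

/-- If a combination of three edge functions is constant, then the coefficients are proportional to
the sines of the angles between the normals. -/
theorem mul_arcSin_eq {n i j k : ℕ} {a b c e : ℝ}
    (h : ∀ z, a * edgeFn n i z + b * edgeFn n j z + c * edgeFn n k z = e) :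
    b * arcSin n i j = c * arcSin n k i ∧ c * arcSin n j k = a * arcSin n i j := by
  -- Differences of the values at `0`, `1` and `I` give the linear relation between the normals; its
  -- cross products with the normals `i` and `j` are the two claims.
  have h0 := h 0
  have h1 := h 1
  have h2 := h Complex.I
  simp only [edgeFn_apply, Complex.zero_re, Complex.zero_im, Complex.one_re, Complex.one_im,
    Complex.I_re, Complex.I_im] at h0 h1 h2
  simp only [arcSin_eq]
  set ci := Real.cos ((2 * i + 1) * Real.pi / n)
  set si := Real.sin ((2 * i + 1) * Real.pi / n)
  set cj := Real.cos ((2 * j + 1) * Real.pi / n)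
  set sj := Real.sin ((2 * j + 1) * Real.pi / n)
  constructor
  · linear_combination ci * (h0 - h2) - si * (h0 - h1)
  · linear_combination cj * (h0 - h2) - sj * (h0 - h1)

/-- The coefficients are proportional to three sines of one sign, while the value at the origin
makes their sum zero. -/
theorem eq_zero_of_edgeFn_sum {n i j k : ℕ} (hn : 3 ≤ n) (ht : (i, j, k) ∈ acuteTriples n)
    {a b c : ℝ} (h : ∀ z, a * edgeFn n i z + b * edgeFn n j z + c * edgeFn n k z = 0) :
    a = 0 ∧ b = 0 ∧ c = 0 := by
  obtain ⟨h1, h2⟩ := mul_arcSin_eq h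
  have hs : a + b + c = 0 := by
    have h0 := h 0
    simp only [edgeFn_zero] at h0
    apply mul_right_cancel₀ (cos_pi_div_pos hn).ne'
    linarith
  have hD : arcSin n j k + arcSin n k i + arcSin n i j ≠ 0 ∧ arcSin n i j ≠ 0 := by
    rcases (mem_acuteTriples.1 ht).2 with ⟨p, q, r⟩ | ⟨p, q, r⟩
    · exact ⟨by positivity, p.ne'⟩
    · exact ⟨by linarith, p.ne⟩
  have hc : c = 0 := by
    apply (mul_eq_zero_iff_right hD.1).1
    linear_combination arcSin n i j * hs + h2 - h1
  rw [hc, zero_mul] at h1 h2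
  exact ⟨(mul_eq_zero_iff_right hD.2).1 h2.symm, (mul_eq_zero_iff_right hD.2).1 h1, hc⟩

/-- The vertex of the hom-polytope belonging to an acute triangle. -/
noncomputable def vertexMap (n : ℕ) (t : ℕ × ℕ × ℕ) : ℂ →ᵃ[ℝ] ℂ :=
  let d := (arcSin n t.2.1 t.2.2 + arcSin n t.2.2 t.1 + arcSin n t.1 t.2.1) *
    Real.cos (Real.pi / n)
  ofBary ![(arcSin n t.2.1 t.2.2 / d) • edgeFn n t.1, (arcSin n t.2.2 t.1 / d) • edgeFn n t.2.1,
    (arcSin n t.1 t.2.1 / d) • edgeFn n t.2.2]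

theorem exists_bary_vertexMap {n i j k : ℕ} (hn : 3 ≤ n) (ht : (i, j, k) ∈ acuteTriples n) :
    ∃ a > 0, ∃ b > 0, ∃ c > 0, ∀ z, bary 0 (vertexMap n (i, j, k) z) = a * edgeFn n i z ∧
      bary 1 (vertexMap n (i, j, k) z) = b * edgeFn n j z ∧
      bary 2 (vertexMap n (i, j, k) z) = c * edgeFn n k z := by
  have hc := cos_pi_div_pos hn
  have hd : (arcSin n j k + arcSin n k i + arcSin n i j) * Real.cos (Real.pi / n) ≠ 0 ∧
      0 < arcSin n j k / ((arcSin n j k + arcSin n k i + arcSin n i j) *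
        Real.cos (Real.pi / n)) ∧
      0 < arcSin n k i / ((arcSin n j k + arcSin n k i + arcSin n i j) *
        Real.cos (Real.pi / n)) ∧
      0 < arcSin n i j / ((arcSin n j k + arcSin n k i + arcSin n i j) *
        Real.cos (Real.pi / n)) := by
    rcases (mem_acuteTriples.1 ht).2 with ⟨p, q, r⟩ | ⟨p, q, r⟩
    · refine ⟨?_, ?_, ?_, ?_⟩ <;> positivity
    · have hD : (arcSin n j k + arcSin n k i + arcSin n i j) * Real.cos (Real.pi / n) < 0 :=
        mul_neg_of_neg_of_pos (by linarith) hc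
      exact ⟨hD.ne, div_pos_of_neg_of_neg q hD, div_pos_of_neg_of_neg r hD,
        div_pos_of_neg_of_neg p hD⟩
  refine ⟨_, hd.2.1, _, hd.2.2.1, _, hd.2.2.2, fun z => ?_⟩
  have hs := arcSin_mul_edgeFn_sum n i j k z
  have h := bary_ofBary (![(arcSin n j k / ((arcSin n j k + arcSin n k i + arcSin n i j) *
      Real.cos (Real.pi / n))) • edgeFn n i, (arcSin n k i / ((arcSin n j k + arcSin n k i +
      arcSin n i j) * Real.cos (Real.pi / n))) • edgeFn n j, (arcSin n i j / ((arcSin n j k +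
      arcSin n k i + arcSin n i j) * Real.cos (Real.pi / n))) • edgeFn n k]) z (by
    simp only [Matrix.cons_val, AffineMap.coe_smul, Pi.smul_apply, smul_eq_mul]
    rw [div_mul_eq_mul_div, div_mul_eq_mul_div, div_mul_eq_mul_div, ← add_div, ← add_div, hs,
      div_self hd.1])
  exact ⟨h 0, h 1, h 2⟩

/-- A nonnegative coordinate of an endpoint vanishes wherever that of the interior point does, so
the endpoint uses the same three edges and `eq_zero_of_edgeFn_sum` identifies the two maps. Full
rank holds because the normals `i` and `j` are independent. -/
theorem vertexMap_mem {n : ℕ} (hn : 3 ≤ n) {t : ℕ × ℕ × ℕ} (ht : t ∈ acuteTriples n) :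
    vertexMap n t ∈ homVerticesOfRank (regularPolygon n) (regularPolygon 3) 2 := by
  obtain ⟨i, j, k⟩ := t
  have hn0 : n ≠ 0 := by omega
  obtain ⟨a, ha, b, hb, c, hc, h⟩ := exists_bary_vertexMap hn ht
  obtain ⟨⟨hi, hj, hk⟩, hsign⟩ := mem_acuteTriples.1 ht
  refine ⟨⟨?_, ?_⟩, ?_⟩
  · rw [mem_homPolytope_iff hn0]
    intro m r
    fin_cases m
    · exact ((h _).1 ▸ mul_nonneg ha.le (edgeFn_zeta_pow_nonneg hn0 hi r) :)
    · exact ((h _).2.1 ▸ mul_nonneg hb.le (edgeFn_zeta_pow_nonneg hn0 hj r) :)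
    · exact ((h _).2.2 ▸ mul_nonneg hc.le (edgeFn_zeta_pow_nonneg hn0 hk r) :)
  · intro x hx y hy hxy
    rw [mem_homPolytope_iff hn0] at hx hy
    obtain ⟨u, v, hu, hv, huv, hf⟩ := hxy
    have hcomb : ∀ m z, bary m (vertexMap n (i, j, k) z) = u * bary m (x z) + v * bary m (y z) := by
      intro m z
      have e : vertexMap n (i, j, k) z = AffineMap.lineMap (x z) (y z) v := by
        rw [← hf, AffineMap.lineMap_apply_module, ← huv]
        simp
      rw [e, AffineMap.apply_lineMap, AffineMap.lineMap_apply_module, ← huv]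
      simp
    have hvan : ∀ m r, bary m (vertexMap n (i, j, k) (zeta n ^ r)) = 0 →
        bary m (x (zeta n ^ r)) = 0 := by
      intro m r h0
      rw [hcomb] at h0
      have h1 := mul_nonneg hu.le (hx m r)
      have h2 := mul_nonneg hv.le (hy m r)
      exact (mul_eq_zero_iff_left hu.ne').1 (by linarith)
    have hedge : ∀ m l d, (∀ z, bary m (vertexMap n (i, j, k) z) = d * edgeFn n l z) →
        ∃ d', ∀ z, bary m (x z) = d' * edgeFn n l z := fun m l d hd =>
      exists_eq_mul_edgeFn hn ((bary m).comp x) l (hvan m l (by rw [hd]; simp))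
        (hvan m (l + 1) (by rw [hd]; simp))
    obtain ⟨a', ha'⟩ := hedge 0 i a fun z => (h z).1
    obtain ⟨b', hb'⟩ := hedge 1 j b fun z => (h z).2.1
    obtain ⟨c', hc'⟩ := hedge 2 k c fun z => (h z).2.2
    obtain ⟨e1, e2, e3⟩ := eq_zero_of_edgeFn_sum hn ht (a := a' - a) (b := b' - b) (c := c' - c)
      fun z => by
        have h1 := bary_sum (x z)
        have h2 := bary_sum (vertexMap n (i, j, k) z)
        rw [ha', hb', hc'] at h1
        rw [(h z).1, (h z).2.1, (h z).2.2] at h2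
        linarith
    ext z
    apply ext_of_bary
    intro m
    fin_cases m
    · exact (ha' z).trans ((h z).1.trans (by rw [sub_eq_zero.1 e1])).symm
    · exact (hb' z).trans ((h z).2.1.trans (by rw [sub_eq_zero.1 e2])).symm
    · exact (hc' z).trans ((h z).2.2.trans (by rw [sub_eq_zero.1 e3])).symm
  · rw [homRank_eq_two_iff hn, ← LinearMap.injective_iff_surjective, injective_iff_map_eq_zero]
    intro w hw
    have hs : arcSin n i j ≠ 0 := by
      rcases hsign with h | h
      · exact h.1.ne'
      · exact h.1.ne
    have hw' : vertexMap n (i, j, k) w = vertexMap n (i, j, k) 0 := by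
      have := (vertexMap n (i, j, k)).map_vadd 0 w
      simpa [hw] using this
    have h1 := (h w).1
    have h2 := (h w).2.1
    rw [hw', (h 0).1] at h1
    rw [hw', (h 0).2.1] at h2
    have h1 := mul_left_cancel₀ ha.ne' h1
    have h2 := mul_left_cancel₀ hb.ne' h2
    simp only [edgeFn_apply, Complex.zero_re, Complex.zero_im] at h1 h2
    rw [arcSin_eq] at hs
    set ci := Real.cos ((2 * i + 1) * Real.pi / n)
    set si := Real.sin ((2 * i + 1) * Real.pi / n)
    set cj := Real.cos ((2 * j + 1) * Real.pi / n)
    set sj := Real.sin ((2 * j + 1) * Real.pi / n)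
    apply Complex.ext
    · apply mul_left_cancel₀ hs
      rw [Complex.zero_re]
      linear_combination sj * h1 - si * h2
    · apply mul_left_cancel₀ hs
      rw [Complex.zero_im]
      linear_combination ci * h2 - cj * h1

theorem exists_vertexMap_eq {n : ℕ} (hn : 3 ≤ n) {f : ℂ →ᵃ[ℝ] ℂ}
    (hf : f ∈ homVerticesOfRank (regularPolygon n) (regularPolygon 3) 2) :
    ∃ t ∈ acuteTriples n, vertexMap n t = f := by
  obtain ⟨hext, hrank⟩ := hf
  rw [homRank_eq_two_iff hn] at hrank
  have hinj : Function.Injective f :=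
    (AffineMap.linear_injective_iff f).1 (LinearMap.injective_iff_surjective.2 hrank)
  have hsurj : Function.Surjective f := (AffineMap.linear_surjective_iff f).1 hrank
  obtain ⟨i, hi, a, ha, ha'⟩ := exists_eq_mul_edgeFn_of_extreme hn hext hsurj 0
  obtain ⟨j, hj, b, hb, hb'⟩ := exists_eq_mul_edgeFn_of_extreme hn hext hsurj 1
  obtain ⟨k, hk, c, hc, hc'⟩ := exists_eq_mul_edgeFn_of_extreme hn hext hsurj 2
  have hsum : ∀ z, a * edgeFn n i z + b * edgeFn n j z + c * edgeFn n k z = 1 := fun z => by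
    rw [← ha', ← hb', ← hc', bary_sum]
  obtain ⟨h1, h2⟩ := mul_arcSin_eq hsum
  have ht : (i, j, k) ∈ acuteTriples n := by
    refine mem_acuteTriples.2 ⟨⟨hi, hj, hk⟩, ?_⟩
    rcases lt_trichotomy (arcSin n i j) 0 with h | h | h
    · right
      have e1 := mul_neg_of_pos_of_neg hb h
      have e2 := mul_neg_of_pos_of_neg ha h
      rw [h1] at e1
      rw [← h2] at e2
      exact ⟨h, (pos_iff_neg_of_mul_neg e2).1 hc, (pos_iff_neg_of_mul_neg e1).1 hc⟩
    -- All three normals would be parallel, and `f` would be constant along the direction `w`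
    -- orthogonal to them.
    · exfalso
      rw [h, mul_zero] at h1 h2
      have h3 := (mul_eq_zero_iff_left hc.ne').1 h1.symm
      rw [arcSin_swap, neg_eq_zero] at h3
      rw [arcSin_eq] at h h3
      set w : ℂ := ⟨-Real.sin ((2 * i + 1) * Real.pi / n), Real.cos ((2 * i + 1) * Real.pi / n)⟩
        with hw
      have hw0 : w = 0 := by
        apply hinj
        apply ext_of_bary
        intro m
        fin_cases m
        · refine (ha' w).trans (Eq.trans ?_ (ha' 0).symm)
          simp only [edgeFn_apply, hw, Complex.zero_re, Complex.zero_im]; ring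
        · refine (hb' w).trans (Eq.trans ?_ (hb' 0).symm)
          simp only [edgeFn_apply, hw, Complex.zero_re, Complex.zero_im]
          linear_combination -b * h
        · refine (hc' w).trans (Eq.trans ?_ (hc' 0).symm)
          simp only [edgeFn_apply, hw, Complex.zero_re, Complex.zero_im]
          linear_combination -c * h3
      have e1 := congrArg Complex.re hw0
      have e2 := congrArg Complex.im hw0
      simp only [hw, Complex.zero_re, Complex.zero_im, neg_eq_zero] at e1 e2
      have := Real.sin_sq_add_cos_sq ((2 * i + 1) * Real.pi / n)
      rw [e1, e2] at this
      norm_num at this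
    · left
      have e1 := mul_pos hb h
      have e2 := mul_pos ha h
      rw [h1] at e1
      rw [← h2] at e2
      exact ⟨h, (pos_iff_pos_of_mul_pos e2).1 hc, (pos_iff_pos_of_mul_pos e1).1 hc⟩
  refine ⟨(i, j, k), ht, ?_⟩
  obtain ⟨a', -, b', -, c', -, h⟩ := exists_bary_vertexMap hn ht
  obtain ⟨e1, e2, e3⟩ := eq_zero_of_edgeFn_sum hn ht (a := a' - a) (b := b' - b) (c := c' - c)
    fun z => by
      have h2 := bary_sum (vertexMap n (i, j, k) z)
      rw [(h z).1, (h z).2.1, (h z).2.2] at h2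
      linarith [hsum z]
  ext z
  apply ext_of_bary
  intro m
  fin_cases m
  · exact (h z).1.trans ((ha' z).trans (by rw [sub_eq_zero.1 e1])).symm
  · exact (h z).2.1.trans ((hb' z).trans (by rw [sub_eq_zero.1 e2])).symm
  · exact (h z).2.2.trans ((hc' z).trans (by rw [sub_eq_zero.1 e3])).symm

theorem edgeFn_index_eq {n i j : ℕ} (hn : 3 ≤ n) (hi : i < n) (hj : j < n) {a b : ℝ} (ha : 0 < a)
    (h : ∀ z, a * edgeFn n i z = b * edgeFn n j z) : i = j := by
  have hab : a = b := by
    have := h 0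
    simp only [edgeFn_zero] at this
    exact mul_right_cancel₀ (cos_pi_div_pos hn).ne' this
  subst hab
  -- At the unit normal of edge `i`, equality forces the angle between the two normals to have
  -- cosine 1.
  have h1 := mul_left_cancel₀ ha.ne' (h ⟨Real.cos ((2 * i + 1) * Real.pi / n),
    Real.sin ((2 * i + 1) * Real.pi / n)⟩)
  have h2 : Real.cos (2 * (Real.pi * ((j : ℝ) - i) / n)) = 1 := by
    have e : 2 * (Real.pi * ((j : ℝ) - i) / n) =
        (2 * j + 1) * Real.pi / n - (2 * i + 1) * Real.pi / n := by ring
    rw [e, Real.cos_sub]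
    simp only [edgeFn_apply] at h1
    linear_combination h1 + Real.sin_sq_add_cos_sq ((2 * i + 1) * Real.pi / n)
  rw [Real.cos_two_mul, Real.cos_sq'] at h2
  have h3 : Real.sin (Real.pi * ((j : ℝ) - i) / n) = 0 := by
    apply pow_eq_zero_iff (two_ne_zero) |>.1
    linarith
  have hi' : (i : ℝ) < n := by exact_mod_cast hi
  have hj' : (j : ℝ) < n := by exact_mod_cast hj
  have hi0 : (0 : ℝ) ≤ i := by positivity
  have hj0 : (0 : ℝ) ≤ j := by positivity
  rcases lt_trichotomy i j with hij | hij | hij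
  · have hij' : (i : ℝ) < j := by exact_mod_cast hij
    exact absurd h3 (sin_pos_of_lt (by linarith) (by linarith)).ne'
  · exact hij
  · have hij' : (j : ℝ) < i := by exact_mod_cast hij
    exact absurd h3 (sin_neg_of_lt (by linarith) (by linarith)).ne

theorem vertexMap_injOn {n : ℕ} (hn : 3 ≤ n) : Set.InjOn (vertexMap n) (acuteTriples n) := by
  rintro ⟨i, j, k⟩ ht ⟨i', j', k'⟩ ht' heq
  rw [Finset.mem_coe] at ht ht'
  obtain ⟨a, ha, b, hb, c, hc, h⟩ := exists_bary_vertexMap hn ht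
  obtain ⟨a', -, b', -, c', -, h'⟩ := exists_bary_vertexMap hn ht'
  obtain ⟨⟨hi, hj, hk⟩, -⟩ := mem_acuteTriples.1 ht
  obtain ⟨⟨hi', hj', hk'⟩, -⟩ := mem_acuteTriples.1 ht'
  rw [← heq] at h'
  rw [edgeFn_index_eq hn hi hi' ha fun z => (h z).1.symm.trans (h' z).1,
    edgeFn_index_eq hn hj hj' hb fun z => (h z).2.1.symm.trans (h' z).2.1,
    edgeFn_index_eq hn hk hk' hc fun z => (h z).2.2.symm.trans (h' z).2.2]

theorem homVerticesOfRank_eq {n : ℕ} (hn : 3 ≤ n) :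
    homVerticesOfRank (regularPolygon n) (regularPolygon 3) 2 =
      vertexMap n '' (acuteTriples n : Set (ℕ × ℕ × ℕ)) := by
  ext f
  constructor
  · exact fun hf => exists_vertexMap_eq hn hf
  · rintro ⟨t, ht, rfl⟩
    exact vertexMap_mem hn ht

theorem mainTheorem8 (n : ℕ) (hn : 3 ≤ n) :
    (homVerticesOfRank (regularPolygon n) (regularPolygon 3) 2).Finite ∧
    (Odd n →
      ((homVerticesOfRank (regularPolygon n) (regularPolygon 3) 2).ncard : ℚ) =
        (n : ℚ) * (n + 1) * (n - 1) / 4) ∧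
    (Even n →
      ((homVerticesOfRank (regularPolygon n) (regularPolygon 3) 2).ncard : ℚ) =
        (n : ℚ) * (n - 2) * (n - 4) / 4) := by
  rw [homVerticesOfRank_eq hn, (vertexMap_injOn hn).ncard_image, Set.ncard_coe_finset,
    card_acuteTriples]
  refine ⟨(Finset.finite_toSet _).image _, ?_, ?_⟩
  · rintro ⟨h, rfl⟩
    rw [card_acuteArcs_odd]
    push_cast
    ring
  · rintro ⟨h, hh⟩
    -- An even `n ≥ 3` is at least 4; this form removes the truncated subtraction in
    -- `card_acuteArcs_even`.
    obtain ⟨h, rfl⟩ : ∃ h', n = 2 * (h' + 1) + 2 := ⟨h - 2, by omega⟩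
    rw [card_acuteArcs_even, Nat.add_sub_cancel]
    push_cast
    ring
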